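/- Theorem. Let $\mathbb{K}$ be a field and let $d,s,L$ be natural numbers. Let $\mathcal{R}$ be a nc Fornasini--Marchesini realization centred at $\underline{Y}=(Y_1,\ldots,Y_d)\in(\mathbb{K}^{s\times s})^d$ and described by $(L;D,C,\underline{\mathbf{A}},\underline{\mathbf{B}})$. That is, $D\in\mathbb{K}^{s\times s}$, $C\in\mathbb{K}^{s\times L}$, the maps $\mathbf{A}_k:\mathbb{K}^{s\times s}\to\mathbb{K}^{L\times L}$ and $\mathbf{B}_k:\mathbb{K}^{s\times s}\to\mathbb{K}^{L\times s}$ ($1\le k\le d$) are linear, and $$\mathcal{R}(\underline{X})=D+C\Big(I_L-\sum_{k=1}^d\mathbf{A}_k(X_k-Y_k)\Big)^{-1}\sum_{k=1}^d\mathbf{B}_k(X_k-Y_k).$$ For a word $\omega=g_{i_1}\cdots g_{i_\ell}$ in the free monoid on $g_1,\ldots,g_d$ put $|\omega|=\ell$ and $\underline{\mathbf{A}}^\omega(X_1,\ldots,X_\ell)=\mathbf{A}_{i_1}(X_1)\cdots\mathbf{A}_{i_\ell}(X_\ell)$ (equal to $I_L$ for the empty word). For every $m\in\mathbb{N}$ let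 $$\Omega_{sm}(\mathcal{R})=\Big\{\underline{X}\in(\mathbb{K}^{sm\times sm})^d:\ \det\Big(I_{Lm}-\sum_{k=1}^d(X_k-I_m\otimes Y_k)\mathbf{A}_k\Big)\ne0\Big\},$$ where $(Z)\mathbf{A}_k:=[\mathbf{A}_k(Z_{ij})]_{1\le i,j\le m}$ for an $m\times m$ block matrix $Z=[Z_{ij}]$ with $s\times s$ blocks, and let $\Omega(\mathcal{R})=\coprod_{m}\Omega_{sm}(\mathcal{R})$. Suppose that 1. $\mathcal{R}$ is controllable: the images of the matrices $\underline{\mathbf{A}}^\omega(X_1,\ldots,X_{|\omega|})\mathbf{B}_k(X_{|\omega|+1})$, over all words $\omega$, all $X_1,\ldots,X_{|\omega|+1}\in\mathbb{K}^{s\times s}$ and all $1\le k\le d$, together span $\mathbb{K}^L$; 2. $\mathcal{R}$ is observable: the kernels of the matrices $C\,\underline{\mathbf{A}}^\omega(X_1,\ldots,X_{|\omega|})$, over all words $\omega$ and all $X_1,\ldots,X_{|\omega|}\in\mathbb{K}^{s\times s}$, have intersection $\{0\}$; 3. the coefficients of $\mathcal{R}$ satisfy the linearized lost-abbey conditions: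 with $[S,Y_k]=SY_k-Y_kS$, for all $S,Z_1,Z_2\in\mathbb{K}^{s\times s}$ and $1\le i_1,i_2\le d$, $$SD-DS=C\sum_{k=1}^d\mathbf{B}_k([S,Y_k]),$$ $$SC\mathbf{B}_{i_1}(Z_1)-C\mathbf{B}_{i_1}(SZ_1)=C\Big(\sum_{k=1}^d\mathbf{A}_k([S,Y_k])\Big)\mathbf{B}_{i_1}(Z_1),$$ $$SC\mathbf{A}_{i_1}(Z_1)-C\mathbf{A}_{i_1}(SZ_1)=C\Big(\sum_{k=1}^d\mathbf{A}_k([S,Y_k])\Big)\mathbf{A}_{i_1}(Z_1),$$ $$\mathbf{B}_{i_1}(Z_1S)-\mathbf{B}_{i_1}(Z_1)S=\mathbf{A}_{i_1}(Z_1)\sum_{k=1}^d\mathbf{B}_k([S,Y_k]),$$ $$\mathbf{A}_{i_1}(Z_1S)\mathbf{B}_{i_2}(Z_2)-\mathbf{A}_{i_1}(Z_1)\mathbf{B}_{i_2}(SZ_2)=\mathbf{A}_{i_1}(Z_1)\Big(\sum_{k=1}^d\mathbf{A}_k([S,Y_k])\Big)\mathbf{B}_{i_2}(Z_2),$$ $$\mathbf{A}_{i_1}(Z_1S)\mathbf{A}_{i_2}(Z_2)-\mathbf{A}_{i_1}(Z_1)\mathbf{A}_{i_2}(SZ_2)=\mathbf{A}_{i_1}(Z_1)\Big(\sum_{k=1}^d\mathbf{A}_k([S,Y_k])\Big)\mathbf{A}_{i_2}(Z_2).$$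 Then $\Omega(\mathcal{R})$ is similarity invariant: for every $m\in\mathbb{N}$, every $\underline{X}=(X_1,\ldots,X_d)\in\Omega_{sm}(\mathcal{R})$ and every invertible $S\in\mathbb{K}^{sm\times sm}$, one has $S\cdot\underline{X}\cdot S^{-1}=(SX_1S^{-1},\ldots,SX_dS^{-1})\in\Omega_{sm}(\mathcal{R})$. -/

import Mathlib

open scoped Kronecker

/-- The nc space over `K^d`: all `d`-tuples of square matrices of a common size `n`. -/
abbrev NCSpace (K : Type*) (d : ℕ) : Type _ :=
  Σ n : ℕ, (Fin d → Matrix (Fin n) (Fin n) K)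

/-- `Ω` is similarity invariant: `T • X • T⁻¹ ∈ Ω` for every `X ∈ Ω` of size `n` and every
invertible `n × n` matrix `T` over `K` (acting on each of the `d` components). -/
def IsSimilarityInvariant {K : Type*} [Field K] {d : ℕ} (Ω : Set (NCSpace K d)) : Prop :=
  ∀ (n : ℕ) (X : Fin d → Matrix (Fin n) (Fin n) K) (T : (Matrix (Fin n) (Fin n) K)ˣ),
    (⟨n, X⟩ : NCSpace K d) ∈ Ω →
      (⟨n, fun k => (T : Matrix (Fin n) (Fin n) K) * X k *
        ((T⁻¹ : (Matrix (Fin n) (Fin n) K)ˣ) : Matrix (Fin n) (Fin n) K)⟩ : NCSpace K d) ∈ Ω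

/-- The data `(L; D, C, A, B)` of a nc Fornasini--Marchesini realization
`D + C (I - ∑ A_k (X_k - Y_k))⁻¹ ∑ B_k (X_k - Y_k)`, with its centre `Y ∈ (K^{s × s})^d`. -/
structure FMRealization (K : Type*) [Field K] (d s L : ℕ) where
  Y : Fin d → Matrix (Fin s) (Fin s) K
  A : Fin d → (Matrix (Fin s) (Fin s) K →ₗ[K] Matrix (Fin L) (Fin L) K)
  B : Fin d → (Matrix (Fin s) (Fin s) K →ₗ[K] Matrix (Fin L) (Fin s) K)
  C : Matrix (Fin s) (Fin L) K
  D : Matrix (Fin s) (Fin s) K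

/-- The natural extension of a linear map `T` on `s₁ × s₂` matrices to `m × m` block matrices with
`s₁ × s₂` blocks: `T` is applied to each block. Row `(i, a)` is row `a` of block row `i`. -/
def blockExtend {K : Type*} [Field K] {s₁ s₂ s₃ s₄ : ℕ} (m : ℕ)
    (T : Matrix (Fin s₁) (Fin s₂) K →ₗ[K] Matrix (Fin s₃) (Fin s₄) K)
    (X : Matrix (Fin m × Fin s₁) (Fin m × Fin s₂) K) :
    Matrix (Fin m × Fin s₃) (Fin m × Fin s₄) K :=
  Matrix.of fun i j => T (Matrix.of fun a b => X (i.1, a) (j.1, b)) i.2 j.2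

/-- View an `sm × sm` matrix as an `m × m` block matrix with `s × s` blocks. -/
def toBlocks {K : Type*} {m s : ℕ} (X : Matrix (Fin (m * s)) (Fin (m * s)) K) :
    Matrix (Fin m × Fin s) (Fin m × Fin s) K :=
  X.submatrix finProdFinEquiv finProdFinEquiv

namespace FMRealization

variable {K : Type*} [Field K] {d s L : ℕ} (R : FMRealization K d s L)

/-- `A^ω(X₁, …, X_ℓ) = A_{i₁}(X₁) ⋯ A_{i_ℓ}(X_ℓ)`; a word `ω = g_{i₁} ⋯ g_{i_ℓ}` together with its
arguments `X₁, …, X_ℓ` is given as the list of the pairs `(i_j, X_j)`. -/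
def wordA (w : List (Fin d × Matrix (Fin s) (Fin s) K)) : Matrix (Fin L) (Fin L) K :=
  (w.map fun p => R.A p.1 p.2).prod

/-- The images of all `A^ω(X₁, …, X_ℓ) B_k(X_{ℓ+1})` span `K^L`. -/
def Controllable : Prop :=
  (⨆ (w : List (Fin d × Matrix (Fin s) (Fin s) K)) (k : Fin d) (X : Matrix (Fin s) (Fin s) K),
    LinearMap.range (R.wordA w * R.B k X).mulVecLin) = ⊤

/-- The kernels of all `C A^ω(X₁, …, X_ℓ)` intersect in `0`. -/
def Observable : Prop :=
  (⨅ w : List (Fin d × Matrix (Fin s) (Fin s) K),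
    LinearMap.ker (R.C * R.wordA w).mulVecLin) = ⊥

/-- The linearized lost-abbey conditions. -/
structure LinearizedLostAbbey : Prop where
  D_comm : ∀ S : Matrix (Fin s) (Fin s) K,
    S * R.D - R.D * S = R.C * ∑ k, R.B k (S * R.Y k - R.Y k * S)
  C_B : ∀ (S Z : Matrix (Fin s) (Fin s) K) (i : Fin d),
    S * R.C * R.B i Z - R.C * R.B i (S * Z) =
      R.C * (∑ k, R.A k (S * R.Y k - R.Y k * S)) * R.B i Z
  C_A : ∀ (S Z : Matrix (Fin s) (Fin s) K) (i : Fin d),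
    S * R.C * R.A i Z - R.C * R.A i (S * Z) =
      R.C * (∑ k, R.A k (S * R.Y k - R.Y k * S)) * R.A i Z
  B_right : ∀ (S Z : Matrix (Fin s) (Fin s) K) (i : Fin d),
    R.B i (Z * S) - R.B i Z * S = R.A i Z * ∑ k, R.B k (S * R.Y k - R.Y k * S)
  A_B : ∀ (S Z₁ Z₂ : Matrix (Fin s) (Fin s) K) (i₁ i₂ : Fin d),
    R.A i₁ (Z₁ * S) * R.B i₂ Z₂ - R.A i₁ Z₁ * R.B i₂ (S * Z₂) =
      R.A i₁ Z₁ * (∑ k, R.A k (S * R.Y k - R.Y k * S)) * R.B i₂ Z₂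
  A_A : ∀ (S Z₁ Z₂ : Matrix (Fin s) (Fin s) K) (i₁ i₂ : Fin d),
    R.A i₁ (Z₁ * S) * R.A i₂ Z₂ - R.A i₁ Z₁ * R.A i₂ (S * Z₂) =
      R.A i₁ Z₁ * (∑ k, R.A k (S * R.Y k - R.Y k * S)) * R.A i₂ Z₂

/-- The pencil `Λ(X) = I_{Lm} - ∑ (X_k - I_m ⊗ Y_k) A_k` at a `d`-tuple of `sm × sm` matrices. -/
def pencil (m : ℕ) (X : Fin d → Matrix (Fin (m * s)) (Fin (m * s)) K) :
    Matrix (Fin m × Fin L) (Fin m × Fin L) K :=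
  1 - ∑ k, blockExtend m (R.A k) (toBlocks (X k) - (1 : Matrix (Fin m) (Fin m) K) ⊗ₖ R.Y k)

/-- `Ω_{sm}(R)`: the `d`-tuples of `sm × sm` matrices at which the pencil is invertible. -/
def OmegaLevel (m : ℕ) : Set (Fin d → Matrix (Fin (m * s)) (Fin (m * s)) K) :=
  {X | (R.pencil m X).det ≠ 0}

/-- `Ω(R)`: the disjoint union of the `Ω_{sm}(R)` in the nc space over `K^d`. -/
def Omega : Set (NCSpace K d) :=
  {P | ∃ (m : ℕ) (X : Fin d → Matrix (Fin (m * s)) (Fin (m * s)) K),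
    X ∈ R.OmegaLevel m ∧ P = ⟨m * s, X⟩}

end FMRealization

/-! Write `P = T`, `Q = T⁻¹`, `E_k = I ⊗ Y_k`, `W_k = P X_k Q - E_k`. A kernel vector `v` of the
pencil at the conjugated tuple satisfies `v = ∑ A_k(W_k) v`. The coefficients need not be
multiplicative, so `T⁻¹ v` has no direct meaning in `K^{Lm}`; the vector `u = ∑ A_k((X_k - E_k) Q)
v` replaces it. The block form `blockExtend_A_A` of the quadratic condition on `A` gives `A_i(Z Q) v
= A_i(Z) u` for all `Z`. Hence `u` lies in the kernel of the pencil at `X`, so `u = 0`. As `Q` is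
invertible, every `A_i(Z) v` vanishes, and so does `v`. -/

/-- The `(i, j)` block of an `m × m` block matrix. -/
def blockAt {K : Type*} {m s₁ s₂ : ℕ} (X : Matrix (Fin m × Fin s₁) (Fin m × Fin s₂) K)
    (i j : Fin m) : Matrix (Fin s₁) (Fin s₂) K :=
  Matrix.of fun a b => X (i, a) (j, b)

theorem blockAt_ext {K : Type*} {m s₁ s₂ : ℕ} {X Z : Matrix (Fin m × Fin s₁) (Fin m × Fin s₂) K}
    (h : ∀ i j, blockAt X i j = blockAt Z i j) : X = Z := by
  ext ⟨i, a⟩ ⟨j, b⟩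
  exact congrFun (congrFun (h i j) a) b

section

variable {K : Type*} [Field K] {m s₁ s₂ s₃ s₄ : ℕ}

theorem blockAt_sub (X Z : Matrix (Fin m × Fin s₁) (Fin m × Fin s₂) K) (i j : Fin m) :
    blockAt (X - Z) i j = blockAt X i j - blockAt Z i j := rfl

theorem blockAt_sum {ι : Type*} (t : Finset ι)
    (X : ι → Matrix (Fin m × Fin s₁) (Fin m × Fin s₂) K) (i j : Fin m) :
    blockAt (∑ k ∈ t, X k) i j = ∑ k ∈ t, blockAt (X k) i j := by
  ext a b
  simp [blockAt, Matrix.sum_apply]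

theorem blockAt_mul (X : Matrix (Fin m × Fin s₁) (Fin m × Fin s₂) K)
    (Z : Matrix (Fin m × Fin s₂) (Fin m × Fin s₃) K) (i j : Fin m) :
    blockAt (X * Z) i j = ∑ k, blockAt X i k * blockAt Z k j := by
  ext a b
  simp [blockAt, Matrix.mul_apply, Matrix.sum_apply, Fintype.sum_prod_type]

theorem blockAt_one_kronecker (Y : Matrix (Fin s₁) (Fin s₂) K) (i j : Fin m) :
    blockAt ((1 : Matrix (Fin m) (Fin m) K) ⊗ₖ Y) i j = if i = j then Y else 0 := by
  ext a b
  by_cases h : i = j <;> simp [blockAt, h]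

theorem blockAt_blockExtend (T : Matrix (Fin s₁) (Fin s₂) K →ₗ[K] Matrix (Fin s₃) (Fin s₄) K)
    (X : Matrix (Fin m × Fin s₁) (Fin m × Fin s₂) K) (i j : Fin m) :
    blockAt (blockExtend m T X) i j = T (blockAt X i j) := rfl

theorem blockExtend_add (T : Matrix (Fin s₁) (Fin s₂) K →ₗ[K] Matrix (Fin s₃) (Fin s₄) K)
    (X Z : Matrix (Fin m × Fin s₁) (Fin m × Fin s₂) K) :
    blockExtend m T (X + Z) = blockExtend m T X + blockExtend m T Z :=
  blockAt_ext fun i j => T.map_add (blockAt X i j) (blockAt Z i j)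

/-- `I ⊗ Y` is block diagonal with equal blocks, so the commutator acts block by block. This lets
the conditions at size `s` pass to size `sm`. -/
theorem blockAt_commutator_one_kronecker (S : Matrix (Fin m × Fin s₁) (Fin m × Fin s₁) K)
    (Y : Matrix (Fin s₁) (Fin s₁) K) (i j : Fin m) :
    blockAt (S * ((1 : Matrix (Fin m) (Fin m) K) ⊗ₖ Y) -
      ((1 : Matrix (Fin m) (Fin m) K) ⊗ₖ Y) * S) i j =
      blockAt S i j * Y - Y * blockAt S i j := by
  simp [blockAt_sub, blockAt_mul, blockAt_one_kronecker]

theorem toBlocks_mul {s : ℕ} (X Z : Matrix (Fin (m * s)) (Fin (m * s)) K) :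
    toBlocks (X * Z) = toBlocks X * toBlocks Z :=
  (Matrix.submatrix_mul_equiv X Z _ _ _).symm

theorem toBlocks_one {s : ℕ} :
    toBlocks (1 : Matrix (Fin (m * s)) (Fin (m * s)) K) = 1 :=
  Matrix.submatrix_one_equiv _

end

namespace FMRealization

variable {K : Type*} [Field K] {d s L : ℕ} {R : FMRealization K d s L}

/-- The lost-abbey condition on products of two coefficients `A` holds for block matrices. -/
theorem LinearizedLostAbbey.blockExtend_A_A (h : R.LinearizedLostAbbey) {m : ℕ}
    (S Z₁ Z₂ : Matrix (Fin m × Fin s) (Fin m × Fin s) K) (i₁ i₂ : Fin d) :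
    blockExtend m (R.A i₁) (Z₁ * S) * blockExtend m (R.A i₂) Z₂ -
        blockExtend m (R.A i₁) Z₁ * blockExtend m (R.A i₂) (S * Z₂) =
      blockExtend m (R.A i₁) Z₁ *
        (∑ k, blockExtend m (R.A k) (S * ((1 : Matrix (Fin m) (Fin m) K) ⊗ₖ R.Y k) -
          ((1 : Matrix (Fin m) (Fin m) K) ⊗ₖ R.Y k) * S)) * blockExtend m (R.A i₂) Z₂ := by
  refine blockAt_ext fun i j => ?_
  rw [mul_assoc]
  rw [blockAt_sub]
  simp only [blockAt_mul, blockAt_blockExtend, blockAt_sum, map_sum,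
    blockAt_commutator_one_kronecker]
  simp only [Finset.sum_mul _ _ (R.A i₂ _), Finset.mul_sum _ _ (R.A i₁ _)]
  -- Once the first sum is reordered, the `(p, q)` terms match `A_A` at the blocks `(Z₁)_{ip}`,
  -- `S_{pq}`, `(Z₂)_{qj}`.
  rw [Finset.sum_comm, ← Finset.sum_sub_distrib]
  refine Finset.sum_congr rfl fun p _ => ?_
  rw [← Finset.sum_sub_distrib]
  refine Finset.sum_congr rfl fun q _ => ?_
  rw [h.A_A, mul_assoc, Finset.sum_mul, Finset.mul_sum]

/-- If the pencil is invertible at `X`, it is invertible at every tuple similar to `X`. -/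
theorem LinearizedLostAbbey.conj_mem_OmegaLevel (h : R.LinearizedLostAbbey) {m : ℕ}
    {X : Fin d → Matrix (Fin (m * s)) (Fin (m * s)) K} (hX : X ∈ R.OmegaLevel m)
    (T : (Matrix (Fin (m * s)) (Fin (m * s)) K)ˣ) :
    (fun k => (T : Matrix (Fin (m * s)) (Fin (m * s)) K) * X k *
      ((T⁻¹ : (Matrix (Fin (m * s)) (Fin (m * s)) K)ˣ) :
        Matrix (Fin (m * s)) (Fin (m * s)) K)) ∈ R.OmegaLevel m := by
  intro hdet
  obtain ⟨v, hv0, hv⟩ := Matrix.exists_mulVec_eq_zero_iff.mpr hdet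
  apply hv0
  set P := toBlocks (T : Matrix (Fin (m * s)) (Fin (m * s)) K) with hP
  set Q := toBlocks ((T⁻¹ : (Matrix (Fin (m * s)) (Fin (m * s)) K)ˣ) :
    Matrix (Fin (m * s)) (Fin (m * s)) K) with hQ
  have hQP : Q * P = 1 := by rw [hP, hQ, ← toBlocks_mul, Units.inv_mul, toBlocks_one]
  have hPQ : P * Q = 1 := by rw [hP, hQ, ← toBlocks_mul, Units.mul_inv, toBlocks_one]
  set E : Fin d → Matrix (Fin m × Fin s) (Fin m × Fin s) K :=
    fun k => (1 : Matrix (Fin m) (Fin m) K) ⊗ₖ R.Y k with hE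
  -- `v` is a fixed vector of the pencil coefficient at the conjugated tuple
  have hfix : ∑ k, (blockExtend m (R.A k) (P * toBlocks (X k) * Q - E k)).mulVec v = v := by
    have hv' := hv
    simp only [pencil, toBlocks_mul, Matrix.sub_mulVec, Matrix.one_mulVec,
      Matrix.sum_mulVec] at hv'
    exact (sub_eq_zero.mp hv').symm
  set u := ∑ k, (blockExtend m (R.A k) ((toBlocks (X k) - E k) * Q)).mulVec v with hu
  -- `u` plays the role of `T⁻¹ v` under the coefficients `A`
  have hmove : ∀ (i : Fin d) (Z : Matrix (Fin m × Fin s) (Fin m × Fin s) K),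
      (blockExtend m (R.A i) (Z * Q)).mulVec v = (blockExtend m (R.A i) Z).mulVec u := by
    intro i Z
    -- Since `Q P = 1`, `[Q, E_k] + Q W_k = (X_k - E_k) Q`.
    have hw : (∑ k, blockExtend m (R.A k) (Q * E k - E k * Q)).mulVec v +
        ∑ k, (blockExtend m (R.A k) (Q * (P * toBlocks (X k) * Q - E k))).mulVec v = u := by
      rw [Matrix.sum_mulVec, ← Finset.sum_add_distrib, hu]
      refine Finset.sum_congr rfl fun k _ => ?_
      rw [← Matrix.add_mulVec, ← blockExtend_add]
      congr 2
      rw [mul_sub, ← mul_assoc, ← mul_assoc, hQP, one_mul, sub_mul]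
      abel
    -- Replacing `v` by `∑ A_k(W_k) v`, on the left and after the commutator factor, creates the
    -- products of coefficients that `A_A` relates.
    conv_lhs => rw [← hfix]
    rw [← hw]
    nth_rewrite 2 [← hfix]
    simp only [Matrix.mulVec_sum, Matrix.mulVec_add, Matrix.mulVec_mulVec]
    rw [← Finset.sum_add_distrib]
    refine Finset.sum_congr rfl fun k _ => ?_
    rw [← Matrix.add_mulVec, ← mul_assoc, ← h.blockExtend_A_A, sub_add_cancel]
  have hu0 : u = 0 := by
    by_contra hne
    refine hX (Matrix.exists_mulVec_eq_zero_iff.mp ⟨u, hne, ?_⟩)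
    simp only [pencil, Matrix.sub_mulVec, Matrix.one_mulVec, Matrix.sum_mulVec]
    rw [sub_eq_zero]
    -- Taking `Z = X_k - E_k` in `hmove` turns the definition of `u` into its fixed-point equation
    -- at `X`.
    conv_lhs => rw [hu]
    exact Finset.sum_congr rfl fun k _ => hmove k _
  rw [← hfix]
  refine Finset.sum_eq_zero fun k _ => ?_
  -- With `Z = W_k P`, `Z Q = W_k`, so each term of `hfix` equals `A_k(Z) u = 0`.
  have := hmove k ((P * toBlocks (X k) * Q - E k) * P)
  rwa [mul_assoc, hPQ, mul_one, hu0, Matrix.mulVec_zero] at this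

end FMRealization

theorem mainTheorem7 {K : Type*} [Field K] {d s L : ℕ} (R : FMRealization K d s L)
    (hcontr : R.Controllable) (hobs : R.Observable) (hLLA : R.LinearizedLostAbbey) :
    IsSimilarityInvariant R.Omega := by
  rintro n X T ⟨m, X', hX', hXX'⟩
  cases hXX'
  exact ⟨m, _, hLLA.conj_mem_OmegaLevel hX' T, rfl⟩
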